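/- For a real random variable $X$ with density $f$ with respect to Lebesgue measure, let $$h(X)=-\int_{\mathbb R} f(x)\log f(x)\,dx\in[-\infty,\infty]$$ (natural logarithm, $0\log 0=0$) denote its differential entropy, with the convention that $h(X)=-\infty$ whenever this integral does not exist (the positive and the negative part of the integrand both have infinite integral), or $X$ has no density. The differential entropy of $X$ is called finite if $-\infty<h(X)<\infty$. **Theorem (Entropy continuity under Gaussian perturbation).** Let $X$ be a random variable in $\mathbb{R}$ with finite differential entropy, for which there exists a real random variable $Y$, independent of $X$ (possibly after enlarging the probability space), with finite differential entropy and such that $h(X+Y)<\infty$. Then, if $Z\sim\mathcal N(0,1)$ is independent of $X$, $$\lim_{t\downarrow 0} h(X+\sqrt{t}\,Z)=h(X).$$ -/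

import Mathlib

open MeasureTheory ProbabilityTheory Filter Topology
open scoped ENNReal

/-- The integral of the positive part of `-f log f` (natural logarithm, `0 log 0 = 0`),
where `f` is the Lebesgue density of the real random variable `X` under `P`. -/
noncomputable def entropyPos {Ω : Type*} [MeasurableSpace Ω] (X : Ω → ℝ) (P : Measure Ω) : ℝ≥0∞ :=
  ∫⁻ x : ℝ, ENNReal.ofReal (Real.negMulLog (pdf X P volume x).toReal)

/-- The integral of the negative part of `-f log f`, that is, of the positive part of `f log f`. -/
noncomputable def entropyNeg {Ω : Type*} [MeasurableSpace Ω] (X : Ω → ℝ) (P : Measure Ω) : ℝ≥0∞ :=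
  ∫⁻ x : ℝ, ENNReal.ofReal (-Real.negMulLog (pdf X P volume x).toReal)

open Classical in
/-- Differential entropy `h(X) = -∫ f log f`, an extended real number. The integral exists, possibly
as `+∞` or `-∞`, when `X` has a Lebesgue density `f` and the positive and negative parts of
`-f log f` do not both have infinite integral; otherwise `h(X) = -∞` by convention. -/
noncomputable def diffEntropy {Ω : Type*} [MeasurableSpace Ω] (X : Ω → ℝ) (P : Measure Ω) : EReal :=
  if HasPDF X P volume ∧ (entropyPos X P ≠ ⊤ ∨ entropyNeg X P ≠ ⊤) then
    (entropyPos X P : EReal) - (entropyNeg X P : EReal)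
  else ⊥

/-! Let `f` be the density of `X`, `μ` its law, and `ρ` the density of `X + √t Z`. Jensen gives
`h(ρ) ≥ h(f)` (`integral_negMulLog_le_smear`), so only the upper bound on the limit needs work. It
comes from a reference function `q`, the convolution of `μ` with `exp(-|x|)`: it is positive,
integrable, and `log q` is 1-Lipschitz. The gap between entropy and cross entropy relative to `q` is
an integral of nonnegative functions, so Fatou makes it lower semicontinuous, while the Lipschitz
bound makes the cross entropy continuous (`integrable_smear_mul_log_laplaceSmoothing`). Subtracting
yields `limsup h(ρ) ≤ h(f)`. All this requires `log q` to be `μ`-integrable, and `Y` serves only for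
that (`integrable_log_laplaceSmoothing`): finiteness of `h(Y)` and `h(X + Y)` bounds `-log q(X +
Y)`, and the Lipschitz property carries the bound back to `X`. -/

/-- The measure on the line with Lebesgue density `f`. -/
noncomputable abbrev lebesgueDensity (f : ℝ → ℝ) : Measure ℝ :=
  volume.withDensity fun x => ENNReal.ofReal (f x)

/-- The convolution `x ↦ ∫ f (x - y) dν(y)` of a function with a measure. -/
noncomputable def smear (f : ℝ → ℝ) (ν : Measure ℝ) (x : ℝ) : ℝ := ∫ y, f (x - y) ∂ν

theorem integrable_lebesgueDensity_iff {f h : ℝ → ℝ} (hf : AEMeasurable f) (h0 : 0 ≤ f) :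
    Integrable h (lebesgueDensity f) ↔ Integrable fun x => f x * h x := by
  rw [lebesgueDensity, integrable_withDensity_iff_integrable_smul₀' (by fun_prop) (by simp)]
  simp [ENNReal.toReal_ofReal (h0 _)]

theorem integral_lebesgueDensity {f : ℝ → ℝ} (hf : AEMeasurable f) (h0 : 0 ≤ f) (h : ℝ → ℝ) :
    ∫ x, h x ∂(lebesgueDensity f) = ∫ x, f x * h x := by
  rw [lebesgueDensity, integral_withDensity_eq_integral_toReal_smul₀ (by fun_prop) (by simp)]
  simp [ENNReal.toReal_ofReal (h0 _)]

theorem integrable_of_isFiniteMeasure_lebesgueDensity {f : ℝ → ℝ} (hf : AEMeasurable f)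
    (h0 : 0 ≤ f) [IsFiniteMeasure (lebesgueDensity f)] : Integrable f := by
  simpa using (integrable_lebesgueDensity_iff hf h0).1 (integrable_const (1 : ℝ))

theorem integral_eq_one_of_isProbabilityMeasure_lebesgueDensity {f : ℝ → ℝ}
    (hf : AEMeasurable f) (h0 : 0 ≤ f) [IsProbabilityMeasure (lebesgueDensity f)] :
    ∫ x, f x = 1 := by
  have := integral_lebesgueDensity hf h0 (fun _ => 1)
  simpa using this.symm

theorem smear_nonneg {f : ℝ → ℝ} {ν : Measure ℝ} (h0 : 0 ≤ f) : 0 ≤ smear f ν :=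
  fun x => integral_nonneg fun y => h0 (x - y)

/-! ### Convolution of a density with a probability measure. -/

section Smear

variable {F f : ℝ → ℝ} {ν : Measure ℝ} [IsProbabilityMeasure ν]

theorem integrable_comp_sub_prod (hF : Integrable F) :
    Integrable (fun p : ℝ × ℝ => F (p.1 - p.2)) (volume.prod ν) :=
  (measurePreserving_sub_prod volume ν).integrable_comp_of_integrable (hF.comp_fst ν)

theorem smear_integrable (hF : Integrable F) : Integrable (smear F ν) :=
  (integrable_comp_sub_prod hF).integral_prod_left

theorem ae_integrable_comp_sub (hF : Integrable F) :
    ∀ᵐ x, Integrable (fun y => F (x - y)) ν :=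
  (integrable_comp_sub_prod hF).prod_right_ae

theorem integral_smear (hF : Integrable F) : ∫ x, smear F ν x = ∫ x, F x := by
  simp only [smear]
  rw [integral_integral_swap (integrable_comp_sub_prod hF)]
  simp [integral_sub_right_eq_self]

/-- Jensen's inequality for the concave function `-u log u`, pointwise in `x`. -/
theorem smear_negMulLog_le (h0 : 0 ≤ f) (hf : Integrable f)
    (hl : Integrable fun x => Real.negMulLog (f x)) :
    ∀ᵐ x, smear (fun x => Real.negMulLog (f x)) ν x ≤ Real.negMulLog (smear f ν x) := by
  filter_upwards [ae_integrable_comp_sub (ν := ν) hf, ae_integrable_comp_sub (ν := ν) hl]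
    with x h1 h2
  exact Real.concaveOn_negMulLog.le_map_integral Real.continuous_negMulLog.continuousOn
    isClosed_Ici (.of_forall fun y => h0 (x - y)) h1 h2

theorem lebesgueDensity_conv (h0 : 0 ≤ f) (hm : Measurable f) (hf : Integrable f) :
    (lebesgueDensity f) ∗ ν = lebesgueDensity (smear f ν) := by
  have key : ∀ᵐ x, ENNReal.ofReal (smear f ν x) = ∫⁻ y, ENNReal.ofReal (f (x - y)) ∂ν := by
    filter_upwards [ae_integrable_comp_sub (ν := ν) hf] with x h1
    exact ofReal_integral_eq_lintegral_ofReal h1 (.of_forall fun y => h0 (x - y))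
  refine Measure.ext_of_lintegral _ fun h hh => ?_
  rw [Measure.conv_comm, Measure.lintegral_conv hh, lebesgueDensity, lebesgueDensity,
    lintegral_withDensity_eq_lintegral_mul₀ (smear_integrable hf).aemeasurable.ennreal_ofReal
      hh.aemeasurable]
  calc _ = ∫⁻ y, (∫⁻ x, ENNReal.ofReal (f (x - y)) * h x) ∂ν := by
        refine lintegral_congr fun y => ?_
        rw [lintegral_withDensity_eq_lintegral_mul _ (by fun_prop) (by fun_prop),
          ← lintegral_sub_right_eq_self _ y]
        simp
    _ = ∫⁻ x, (∫⁻ y, ENNReal.ofReal (f (x - y)) * h x ∂ν) :=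
        lintegral_lintegral_swap (by fun_prop)
    _ = _ := by
        refine lintegral_congr_ae ?_
        filter_upwards [key] with x hx
        rw [lintegral_mul_const _ (by fun_prop), ← hx]
        rfl

end Smear

/-! ### Differential entropy as a Bochner integral. -/

section Entropy

variable {Ω : Type*} [MeasurableSpace Ω] {P : Measure Ω} {W : Ω → ℝ} {r : ℝ → ℝ}

theorem pdf_toReal_ae_eq (hW : HasLaw W (lebesgueDensity r) P) (h0 : 0 ≤ r) (hr : AEMeasurable r) :
    ∀ᵐ x, (pdf W P volume x).toReal = r x := by
  have : HasPDF W P volume := hasPDF_of_map_eq_withDensity hW.aemeasurable _ (by fun_prop) hW.map_eq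
  filter_upwards [(pdf.eq_of_map_eq_withDensity' _ (by fun_prop)).1 hW.map_eq] with x hx
  rw [hx, ENNReal.toReal_ofReal (h0 x)]

theorem entropyPos_eq (hW : HasLaw W (lebesgueDensity r) P) (h0 : 0 ≤ r) (hr : AEMeasurable r) :
    entropyPos W P = ∫⁻ x, ENNReal.ofReal (Real.negMulLog (r x)) := by
  refine lintegral_congr_ae ?_
  filter_upwards [pdf_toReal_ae_eq hW h0 hr] with x hx
  rw [hx]

theorem entropyNeg_eq (hW : HasLaw W (lebesgueDensity r) P) (h0 : 0 ≤ r) (hr : AEMeasurable r) :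
    entropyNeg W P = ∫⁻ x, ENNReal.ofReal (-Real.negMulLog (r x)) := by
  refine lintegral_congr_ae ?_
  filter_upwards [pdf_toReal_ae_eq hW h0 hr] with x hx
  rw [hx]

theorem lintegral_ofReal_ne_top_of_integrable {h : ℝ → ℝ} (hh : Integrable h) :
    ∫⁻ x, ENNReal.ofReal (h x) ≠ ⊤ :=
  ((lintegral_mono fun x => Real.ofReal_le_enorm (h x)).trans_lt hh.2).ne

theorem integrable_of_lintegral_ofReal_ne_top {h : ℝ → ℝ} (hm : AEStronglyMeasurable h)
    (hp : ∫⁻ x, ENNReal.ofReal (h x) ≠ ⊤) (hn : ∫⁻ x, ENNReal.ofReal (-h x) ≠ ⊤) :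
    Integrable h := by
  refine ⟨hm, ?_⟩
  calc ∫⁻ x, ‖h x‖ₑ ≤ ∫⁻ x, (ENNReal.ofReal (h x) + ENNReal.ofReal (-h x)) := by
        refine lintegral_mono fun x => ?_
        rw [Real.enorm_eq_ofReal_abs]
        rcases abs_cases (h x) with h | h <;> rw [h.1] <;> simp
    _ = (∫⁻ x, ENNReal.ofReal (h x)) + ∫⁻ x, ENNReal.ofReal (-h x) :=
        lintegral_add_left' hm.aemeasurable.ennreal_ofReal _
    _ < ⊤ := ENNReal.add_lt_top.2 ⟨hp.lt_top, hn.lt_top⟩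

theorem diffEntropy_eq_integral (hW : HasLaw W (lebesgueDensity r) P) (h0 : 0 ≤ r)
    (hr : AEMeasurable r) (hl : Integrable fun x => Real.negMulLog (r x)) :
    diffEntropy W P = ((∫ x, Real.negMulLog (r x) : ℝ) : EReal) := by
  have hpdf : HasPDF W P volume :=
    hasPDF_of_map_eq_withDensity hW.aemeasurable _ (by fun_prop) hW.map_eq
  have hp := lintegral_ofReal_ne_top_of_integrable hl
  have hn := lintegral_ofReal_ne_top_of_integrable hl.neg
  simp only [Pi.neg_apply] at hn
  rw [diffEntropy, entropyPos_eq hW h0 hr, entropyNeg_eq hW h0 hr, if_pos ⟨hpdf, .inl hp⟩,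
    integral_eq_lintegral_pos_part_sub_lintegral_neg_part hl, EReal.coe_sub,
    EReal.coe_ennreal_toReal hp, EReal.coe_ennreal_toReal hn]

theorem integrable_negMulLog_of_diffEntropy_lt_top (hW : HasLaw W (lebesgueDensity r) P)
    (h0 : 0 ≤ r) (hr : AEMeasurable r)
    (hn : ∫⁻ x, ENNReal.ofReal (-Real.negMulLog (r x)) ≠ ⊤) (h : diffEntropy W P < ⊤) :
    Integrable fun x => Real.negMulLog (r x) := by
  have hpdf : HasPDF W P volume :=
    hasPDF_of_map_eq_withDensity hW.aemeasurable _ (by fun_prop) hW.map_eq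
  refine integrable_of_lintegral_ofReal_ne_top
    (Real.continuous_negMulLog.comp_aestronglyMeasurable hr.aestronglyMeasurable) ?_ hn
  intro hp
  rw [diffEntropy, entropyPos_eq hW h0 hr, entropyNeg_eq hW h0 hr, if_pos ⟨hpdf, .inr hn⟩, hp,
    ← EReal.coe_ennreal_toReal hn] at h
  simp at h

theorem exists_density_of_diffEntropy_finite [IsProbabilityMeasure P]
    (h : ⊥ < diffEntropy W P ∧ diffEntropy W P < ⊤) :
    ∃ f : ℝ → ℝ, 0 ≤ f ∧ Measurable f ∧ HasLaw W (lebesgueDensity f) P ∧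
      Integrable fun x => Real.negMulLog (f x) := by
  by_cases hc : HasPDF W P volume ∧ (entropyPos W P ≠ ⊤ ∨ entropyNeg W P ≠ ⊤)
  swap
  · simp [diffEntropy, hc] at h
  have hpdf := hc.1
  have hW : HasLaw W (lebesgueDensity fun x => (pdf W P volume x).toReal) P :=
    ⟨hpdf.aemeasurable', by
      rw [map_eq_withDensity_pdf W P volume, lebesgueDensity,
        withDensity_congr_ae pdf.ofReal_toReal_ae_eq]⟩
  have h0 : 0 ≤ fun x => (pdf W P volume x).toReal := fun x => ENNReal.toReal_nonneg
  have hm : Measurable fun x => (pdf W P volume x).toReal := (measurable_pdf W P).ennreal_toReal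
  refine ⟨_, h0, hm, hW, integrable_negMulLog_of_diffEntropy_lt_top hW h0 hm.aemeasurable ?_ h.2⟩
  intro hn
  have hn' : entropyNeg W P = ⊤ := hn
  rw [diffEntropy, if_pos hc, hn'] at h
  simp at h

end Entropy

/-! ### The reference function and its Lipschitz logarithm. -/

theorem integrable_exp_neg_abs : Integrable fun x : ℝ => Real.exp (-|x|) := by
  rw [← integrableOn_univ, ← Set.Iic_union_Ioi (a := (0 : ℝ)), integrableOn_union]
  constructor
  · refine (integrableOn_exp_Iic 0).congr_fun (fun x hx => ?_) measurableSet_Iic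
    simp [abs_of_nonpos (Set.mem_Iic.1 hx)]
  · refine (integrableOn_exp_neg_Ioi 0).congr_fun (fun x hx => ?_) measurableSet_Ioi
    simp [abs_of_pos (Set.mem_Ioi.1 hx)]

/-- The convolution of a measure with the two-sided exponential kernel. -/
noncomputable def laplaceSmoothing (μ : Measure ℝ) : ℝ → ℝ := smear (fun x => Real.exp (-|x|)) μ

section Laplace

variable (μ : Measure ℝ) [IsProbabilityMeasure μ]

theorem integrable_exp_neg_abs_sub (x : ℝ) : Integrable (fun y => Real.exp (-|x - y|)) μ := by
  refine Integrable.of_bound (C := 1) (by fun_prop) (.of_forall fun y => ?_)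
  simp

theorem laplaceSmoothing_pos (x : ℝ) : 0 < laplaceSmoothing μ x :=
  integral_exp_pos (integrable_exp_neg_abs_sub μ x)

theorem laplaceSmoothing_le_one (x : ℝ) : laplaceSmoothing μ x ≤ 1 := by
  calc laplaceSmoothing μ x ≤ ∫ _, (1 : ℝ) ∂μ :=
        integral_mono (integrable_exp_neg_abs_sub μ x) (integrable_const _) fun y => by simp
    _ = 1 := by simp

theorem integrable_laplaceSmoothing : Integrable (laplaceSmoothing μ) :=
  smear_integrable integrable_exp_neg_abs

theorem log_laplaceSmoothing_nonpos (x : ℝ) : Real.log (laplaceSmoothing μ x) ≤ 0 :=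
  Real.log_nonpos (laplaceSmoothing_pos μ x).le (laplaceSmoothing_le_one μ x)

/-- The kernel `exp(-|x|)` changes by a factor of at most `exp |y|` under translation by `y`, and
averaging over `μ` preserves this. -/
theorem log_laplaceSmoothing_add_le (x y : ℝ) :
    Real.log (laplaceSmoothing μ (x + y)) ≤ Real.log (laplaceSmoothing μ x) + |y| := by
  rw [← Real.log_exp |y|, ← Real.log_mul (laplaceSmoothing_pos μ x).ne' (Real.exp_pos _).ne']
  refine Real.log_le_log (laplaceSmoothing_pos μ _) ?_
  simp only [laplaceSmoothing, smear]
  rw [← integral_mul_const]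
  refine integral_mono (integrable_exp_neg_abs_sub μ _)
    ((integrable_exp_neg_abs_sub μ _).mul_const _) fun z => ?_
  simp only [← Real.exp_add]
  refine Real.exp_le_exp.2 ?_
  have := abs_sub_abs_le_abs_sub (x - z) (x + y - z)
  have h : x - z - (x + y - z) = -y := by ring
  rw [h, abs_neg] at this
  linarith

theorem abs_log_laplaceSmoothing_add_sub_le (x y : ℝ) :
    |Real.log (laplaceSmoothing μ (x + y)) - Real.log (laplaceSmoothing μ x)| ≤ |y| := by
  have h1 := log_laplaceSmoothing_add_le μ x y
  have h2 := log_laplaceSmoothing_add_le μ (x + y) (-y)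
  rw [add_neg_cancel_right, abs_neg] at h2
  exact abs_le.2 ⟨by linarith, by linarith⟩

theorem continuous_log_laplaceSmoothing :
    Continuous fun x => Real.log (laplaceSmoothing μ x) := by
  have : LipschitzWith 1 fun x => Real.log (laplaceSmoothing μ x) := by
    refine LipschitzWith.of_dist_le_mul fun x y => ?_
    simpa [Real.dist_eq] using abs_log_laplaceSmoothing_add_sub_le μ y (x - y)
  exact this.continuous

theorem continuous_laplaceSmoothing : Continuous (laplaceSmoothing μ) := by
  rw [show laplaceSmoothing μ = fun x => Real.exp (Real.log (laplaceSmoothing μ x)) from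
    funext fun x => (Real.exp_log (laplaceSmoothing_pos μ x)).symm]
  exact Real.continuous_exp.comp (continuous_log_laplaceSmoothing μ)

end Laplace

/-! ### Finiteness of the cross entropy of `X` relative to the reference function. -/

section CrossEntropy

variable {f g : ℝ → ℝ}

theorem integrable_log_lebesgueDensity (h0 : 0 ≤ f) (hf : AEMeasurable f)
    (hl : Integrable fun x => Real.negMulLog (f x)) :
    Integrable (fun x => Real.log (f x)) (lebesgueDensity f) := by
  rw [integrable_lebesgueDensity_iff hf h0]
  refine hl.neg.congr (.of_forall fun x => ?_)
  simp [Real.negMulLog]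

theorem ae_pos_lebesgueDensity (hf : AEMeasurable f) : ∀ᵐ x ∂(lebesgueDensity f), 0 < f x := by
  rw [lebesgueDensity, ae_withDensity_iff' (by fun_prop)]
  exact .of_forall fun x hx => by simpa using hx

/-- The density `g` cancels the denominator `g p.2`, with inequality only because of points where
`g` vanishes. After substituting `w = x + y`, integrating `exp(-|w - x|)` over `μ` reproduces
`laplaceSmoothing μ w`, which cancels the other denominator. -/
theorem lintegral_laplace_ratio_le (μ : Measure ℝ) [IsProbabilityMeasure μ] {ρ : ℝ → ℝ}
    (hρ0 : 0 ≤ ρ) (hρ : Measurable ρ) (hg : Measurable g) :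
    ∫⁻ p, ENNReal.ofReal (ρ (p.1 + p.2) / laplaceSmoothing μ (p.1 + p.2) *
        (Real.exp (-|p.2|) / g p.2)) ∂(μ.prod (lebesgueDensity g)) ≤
      ∫⁻ x, ENNReal.ofReal (ρ x) := by
  have hq := (continuous_laplaceSmoothing μ).measurable
  rw [lintegral_prod _ (by fun_prop)]
  calc _ ≤ ∫⁻ x, (∫⁻ w, ENNReal.ofReal (ρ w / laplaceSmoothing μ w) *
          ENNReal.ofReal (Real.exp (-|w - x|))) ∂μ := by
        refine lintegral_mono fun x => ?_
        rw [lebesgueDensity, lintegral_withDensity_eq_lintegral_mul _ (by fun_prop) (by fun_prop)]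
        rw [← lintegral_add_left_eq_self (fun w => ENNReal.ofReal (ρ w / laplaceSmoothing μ w) *
          ENNReal.ofReal (Real.exp (-|w - x|))) x]
        refine lintegral_mono fun y => ?_
        have hnn : 0 ≤ ρ (x + y) / laplaceSmoothing μ (x + y) :=
          div_nonneg (hρ0 _) (laplaceSmoothing_pos μ _).le
        rw [Pi.mul_apply, ENNReal.ofReal_mul hnn, mul_left_comm, add_sub_cancel_left]
        gcongr
        rcases le_or_gt (g y) 0 with h | h
        · simp [ENNReal.ofReal_of_nonpos h]
        · rw [← ENNReal.ofReal_mul h.le, mul_div_cancel₀ _ h.ne']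
    _ = ∫⁻ w, (∫⁻ x, ENNReal.ofReal (ρ w / laplaceSmoothing μ w) *
          ENNReal.ofReal (Real.exp (-|w - x|)) ∂μ) := lintegral_lintegral_swap (by fun_prop)
    _ = _ := by
        refine lintegral_congr fun w => ?_
        have hq0 := laplaceSmoothing_pos μ w
        rw [lintegral_const_mul _ (by fun_prop),
          ← ofReal_integral_eq_lintegral_ofReal (integrable_exp_neg_abs_sub μ w)
            (.of_forall fun y => (Real.exp_pos _).le),
          ← ENNReal.ofReal_mul (div_nonneg (hρ0 w) hq0.le)]
        change ENNReal.ofReal (ρ w / laplaceSmoothing μ w * laplaceSmoothing μ w) = _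
        rw [div_mul_cancel₀ _ hq0.ne']

/-- This is `log t ≤ t - 1` at the ratio `t` on the right, whose expectation
`lintegral_laplace_ratio_le` controls. -/
theorem neg_log_le_of_ratio {q r γ a : ℝ} (hq : 0 < q) (hr : 0 < r) (hγ : 0 < γ) :
    -Real.log q ≤ |Real.log r| + |Real.log γ| + |a| + r / q * (Real.exp (-|a|) / γ) := by
  have h := Real.log_le_sub_one_of_pos
    (show 0 < r / q * (Real.exp (-|a|) / γ) by positivity)
  rw [Real.log_mul (by positivity) (by positivity), Real.log_div hr.ne' hq.ne',
    Real.log_div (Real.exp_pos _).ne' hγ.ne', Real.log_exp] at h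
  linarith [neg_abs_le (Real.log r), le_abs_self (Real.log γ)]

/-- If `X` and `Y` are independent with densities `f` and `g`, and the entropies of `Y` and of
`X + Y` are finite, then the cross entropy of `X` relative to its smoothing is finite. -/
theorem integrable_log_laplaceSmoothing (hf0 : 0 ≤ f) (hf : Measurable f)
    [IsProbabilityMeasure (lebesgueDensity f)] (hg0 : 0 ≤ g) (hg : Measurable g)
    [IsProbabilityMeasure (lebesgueDensity g)]
    (hgl : Integrable fun x => Real.negMulLog (g x))
    (hl : Integrable fun x => Real.negMulLog (smear f (lebesgueDensity g) x)) :
    Integrable (fun x => Real.log (laplaceSmoothing (lebesgueDensity f) x))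
      (lebesgueDensity f) := by
  set μ := lebesgueDensity f with hμ
  set ν := lebesgueDensity g with hν
  have hfi := integrable_of_isFiniteMeasure_lebesgueDensity hf.aemeasurable hf0
  set ρ := smear f ν with hρ
  have hρ0 : 0 ≤ ρ := smear_nonneg hf0
  have hρm : Measurable ρ := by
    have : StronglyMeasurable ρ := StronglyMeasurable.integral_prod_right (f := fun x y => f (x - y))
      (by fun_prop)
    exact this.measurable
  have hρi : Integrable ρ := smear_integrable hfi
  have hconv : μ ∗ ν = lebesgueDensity ρ := lebesgueDensity_conv hf0 hf hfi
  have hlogρ : Integrable (fun p : ℝ × ℝ => Real.log (ρ (p.1 + p.2))) (μ.prod ν) := by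
    have := integrable_log_lebesgueDensity hρ0 hρm.aemeasurable hl
    rw [← hconv, Measure.conv, integrable_map_measure
      (by exact (Real.measurable_log.comp hρm).aestronglyMeasurable) (by fun_prop)] at this
    exact this
  have hρpos : ∀ᵐ p ∂(μ.prod ν), 0 < ρ (p.1 + p.2) := by
    have := ae_pos_lebesgueDensity hρm.aemeasurable
    rw [← hconv, Measure.conv] at this
    exact ae_of_ae_map (p := fun x => 0 < ρ x) (by fun_prop) this
  have hlogg : Integrable (fun p : ℝ × ℝ => Real.log (g p.2)) (μ.prod ν) :=
    (integrable_log_lebesgueDensity hg0 hg.aemeasurable hgl).comp_snd μ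
  have hgpos : ∀ᵐ p ∂(μ.prod ν), 0 < g p.2 :=
    Measure.quasiMeasurePreserving_snd.ae (ae_pos_lebesgueDensity hg.aemeasurable)
  have hqm := (continuous_laplaceSmoothing μ).measurable
  have hR : Integrable (fun p : ℝ × ℝ => ρ (p.1 + p.2) / laplaceSmoothing μ (p.1 + p.2) *
      (Real.exp (-|p.2|) / g p.2)) (μ.prod ν) := by
    refine ⟨by fun_prop, ?_⟩
    rw [hasFiniteIntegral_iff_ofReal (.of_forall fun p => mul_nonneg
      (div_nonneg (hρ0 _) (laplaceSmoothing_pos μ _).le) (div_nonneg (Real.exp_pos _).le (hg0 _)))]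
    exact (lintegral_laplace_ratio_le μ hρ0 hρm hg).trans_lt
      (lintegral_ofReal_ne_top_of_integrable hρi).lt_top
  -- `Y` need not have a first moment. The weight `(1 + |y|)⁻¹` absorbs the two terms `|y|`, one
  -- from `neg_log_le_of_ratio` and one from the Lipschitz bound; hence the constant 2 below.
  have hjoint : Integrable (fun p : ℝ × ℝ =>
      (1 + |p.2|)⁻¹ * Real.log (laplaceSmoothing μ p.1)) (μ.prod ν) := by
    refine Integrable.mono' (((hlogρ.abs.add hlogg.abs).add (integrable_const 2)).add hR)
      (by fun_prop) ?_
    filter_upwards [hρpos, hgpos] with p h1 h2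
    have hq := laplaceSmoothing_pos μ (p.1 + p.2)
    have hle := neg_log_le_of_ratio (a := p.2) hq h1 h2
    have hlip := (abs_le.1 (abs_log_laplaceSmoothing_add_sub_le μ p.1 p.2)).2
    have hR0 : 0 ≤ ρ (p.1 + p.2) / laplaceSmoothing μ (p.1 + p.2) *
        (Real.exp (-|p.2|) / g p.2) := by positivity
    have hc : 0 < 1 + |p.2| := by positivity
    rw [Real.norm_eq_abs, abs_mul, abs_of_pos (inv_pos.2 hc),
      abs_of_nonpos (log_laplaceSmoothing_nonpos μ _), inv_mul_le_iff₀ hc]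
    simp only [Pi.add_apply]
    nlinarith [abs_nonneg p.2, abs_nonneg (Real.log (ρ (p.1 + p.2))), abs_nonneg (Real.log (g p.2)),
      mul_nonneg (abs_nonneg p.2) (abs_nonneg (Real.log (ρ (p.1 + p.2)))),
      mul_nonneg (abs_nonneg p.2) (abs_nonneg (Real.log (g p.2))),
      mul_nonneg (abs_nonneg p.2) hR0]
  -- By Fubini some fixed `y` gives integrability in `x`, and there the weight is a nonzero
  -- constant.
  obtain ⟨y, hy⟩ := hjoint.prod_left_ae.exists
  have := hy.const_mul (1 + |y|)
  refine this.congr (.of_forall fun x => ?_)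
  exact mul_inv_cancel_left₀ (by positivity) _

end CrossEntropy

/-! ### Approximation of a density in `L¹` by convolution with shrinking measures. -/

section Translation

variable {f : ℝ → ℝ}

theorem tendsto_lintegral_enorm_comp_sub_sub (hf : Integrable f) :
    Tendsto (fun y => ∫⁻ x, ‖f (x - y) - f x‖ₑ) (𝓝 0) (𝓝 0) := by
  have hf' : MemLp f 1 volume := memLp_one_iff_integrable.2 hf
  have : Fact ((1 : ℝ≥0∞) ≠ ⊤) := ⟨ENNReal.one_ne_top⟩
  -- Translations act continuously on `L¹`; `DomAddAct.mk c` acts by `x ↦ f (c + x)`, whence the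
  -- sign.
  have hc : Continuous fun y : ℝ => DomAddAct.mk (-y) +ᵥ hf'.toLp f := by
    have : Continuous fun y : ℝ => DomAddAct.mk (-y) :=
      DomAddAct.continuous_mk.comp continuous_neg
    exact this.vadd continuous_const
  have h := (hc.edist (continuous_const (y := DomAddAct.mk (-(0 : ℝ)) +ᵥ hf'.toLp f))).tendsto 0
  rw [edist_self] at h
  refine h.congr fun y => ?_
  rw [DomAddAct.mk_vadd_toLp, DomAddAct.mk_vadd_toLp, Lp.edist_toLp_toLp,
    eLpNorm_one_eq_lintegral_enorm]
  simp [sub_eq_neg_add]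

theorem lintegral_enorm_comp_sub_sub_le (hf : Measurable f) (y : ℝ) :
    ∫⁻ x, ‖f (x - y) - f x‖ₑ ≤ 2 * ∫⁻ x, ‖f x‖ₑ := by
  calc _ ≤ ∫⁻ x, (‖f (x - y)‖ₑ + ‖f x‖ₑ) := lintegral_mono fun x => enorm_sub_le
    _ = _ := by
      rw [lintegral_add_left (by fun_prop), lintegral_sub_right_eq_self (fun x => ‖f x‖ₑ), two_mul]

theorem lintegral_enorm_smear_sub_le (hm : Measurable f) (hf : Integrable f) (ν : Measure ℝ)
    [IsProbabilityMeasure ν] :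
    ∫⁻ x, ‖smear f ν x - f x‖ₑ ≤ ∫⁻ y, (∫⁻ x, ‖f (x - y) - f x‖ₑ) ∂ν := by
  calc _ ≤ ∫⁻ x, (∫⁻ y, ‖f (x - y) - f x‖ₑ ∂ν) := by
        refine lintegral_mono_ae ?_
        filter_upwards [ae_integrable_comp_sub (ν := ν) hf] with x hx
        have : smear f ν x - f x = ∫ y, (f (x - y) - f x) ∂ν := by
          rw [integral_sub hx (integrable_const _)]
          simp [smear]
        rw [this]
        exact enorm_integral_le_lintegral_enorm _
    _ = _ := lintegral_lintegral_swap (by fun_prop)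

instance isProbabilityMeasure_map_mul (γ : Measure ℝ) [IsProbabilityMeasure γ] (s : ℝ) :
    IsProbabilityMeasure (γ.map (s * ·)) :=
  Measure.isProbabilityMeasure_map (by fun_prop)

theorem tendsto_eLpNorm_smear_map_mul_sub (hm : Measurable f) (hf : Integrable f) (γ : Measure ℝ)
    [IsProbabilityMeasure γ] :
    Tendsto (fun s => eLpNorm (smear f (γ.map (s * ·)) - f) 1 volume) (𝓝 0) (𝓝 0) := by
  have hT : Measurable fun y => ∫⁻ x, ‖f (x - y) - f x‖ₑ :=
    Measurable.lintegral_prod_right' (f := fun p : ℝ × ℝ => ‖f (p.2 - p.1) - f p.2‖ₑ) (by fun_prop)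
  have hlim : Tendsto (fun s => ∫⁻ z, (∫⁻ x, ‖f (x - s * z) - f x‖ₑ) ∂γ) (𝓝 0) (𝓝 0) := by
    rw [show (0 : ℝ≥0∞) = ∫⁻ _, 0 ∂γ by simp]
    refine tendsto_lintegral_filter_of_dominated_convergence (fun _ => 2 * ∫⁻ x, ‖f x‖ₑ)
      (.of_forall fun s => hT.comp (measurable_const_mul s))
      (.of_forall fun s => .of_forall fun z => lintegral_enorm_comp_sub_sub_le hm _) ?_
      (.of_forall fun z => ?_)
    · simpa using ENNReal.mul_ne_top ENNReal.ofNat_ne_top hf.2.ne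
    · refine (tendsto_lintegral_enorm_comp_sub_sub hf).comp ?_
      have : Tendsto (fun s : ℝ => s * z) (𝓝 0) (𝓝 (0 * z)) := tendsto_id.mul_const z
      rwa [zero_mul] at this
  refine tendsto_of_tendsto_of_tendsto_of_le_of_le tendsto_const_nhds hlim (fun _ => zero_le)
    fun s => ?_
  rw [eLpNorm_one_eq_lintegral_enorm]
  refine (lintegral_enorm_smear_sub_le hm hf _).trans_eq ?_
  exact lintegral_map hT (by fun_prop)

end Translation

/-! ### Convergence of entropies under shrinking perturbations. -/

section EntropyLimit

theorem negMulLog_le_cross {u q : ℝ} (hu : 0 ≤ u) (hq : 0 < q) :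
    Real.negMulLog u ≤ -(u * Real.log q) + q - u := by
  rcases hu.eq_or_lt with rfl | hu
  · simpa using hq.le
  · have h := Real.log_le_sub_one_of_pos (div_pos hq hu)
    rw [Real.log_div hq.ne' hu.ne'] at h
    have := mul_le_mul_of_nonneg_left h hu.le
    rw [mul_sub, mul_sub, mul_div_cancel₀ _ hu.ne'] at this
    rw [Real.negMulLog]
    linarith

theorem integral_negMulLog_le_smear {f : ℝ → ℝ} (h0 : 0 ≤ f) (hf : Integrable f)
    (hl : Integrable fun x => Real.negMulLog (f x)) {ν : Measure ℝ} [IsProbabilityMeasure ν]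
    (hlν : Integrable fun x => Real.negMulLog (smear f ν x)) :
    ∫ x, Real.negMulLog (f x) ≤ ∫ x, Real.negMulLog (smear f ν x) := by
  rw [← integral_smear (ν := ν) hl]
  exact integral_mono_ae (smear_integrable hl) hlν (smear_negMulLog_le h0 hf hl)

variable {f : ℝ → ℝ} [IsProbabilityMeasure (lebesgueDensity f)]

/-- Both integrals are expectations on the product space, of `log q (X + W)` and `log q X` with `W ∼
ν`; they differ by at most `|W|` pointwise. -/
theorem integrable_smear_mul_log_laplaceSmoothing (h0 : 0 ≤ f) (hm : Measurable f)
    (hL : Integrable (fun x => Real.log (laplaceSmoothing (lebesgueDensity f) x))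
      (lebesgueDensity f)) {ν : Measure ℝ} [IsProbabilityMeasure ν] (hν : Integrable id ν) :
    Integrable (fun x => smear f ν x * Real.log (laplaceSmoothing (lebesgueDensity f) x)) ∧
    |(∫ x, smear f ν x * Real.log (laplaceSmoothing (lebesgueDensity f) x)) -
      ∫ x, f x * Real.log (laplaceSmoothing (lebesgueDensity f) x)| ≤ ∫ y, |y| ∂ν := by
  set μ := lebesgueDensity f with hμ
  have hf := integrable_of_isFiniteMeasure_lebesgueDensity hm.aemeasurable h0
  have hρ := (smear_integrable (ν := ν) hf).aemeasurable
  have hρ0 := smear_nonneg (ν := ν) h0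
  have hLc := continuous_log_laplaceSmoothing μ
  have hconv : μ ∗ ν = lebesgueDensity (smear f ν) := lebesgueDensity_conv h0 hm hf
  have hfst : Integrable (fun p : ℝ × ℝ => Real.log (laplaceSmoothing μ p.1)) (μ.prod ν) :=
    hL.comp_fst ν
  have habs : Integrable (fun p : ℝ × ℝ => |p.2|) (μ.prod ν) := hν.abs.comp_snd μ
  have hsum : Integrable (fun p : ℝ × ℝ => Real.log (laplaceSmoothing μ (p.1 + p.2)))
      (μ.prod ν) := by
    refine (hfst.abs.add habs).mono' (hLc.comp continuous_add).aestronglyMeasurable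
      (.of_forall fun p => ?_)
    have h1 := abs_log_laplaceSmoothing_add_sub_le μ p.1 p.2
    have h2 := abs_sub_abs_le_abs_sub (Real.log (laplaceSmoothing μ (p.1 + p.2)))
      (Real.log (laplaceSmoothing μ p.1))
    simp only [Real.norm_eq_abs, Pi.add_apply]
    linarith
  have hint : Integrable (fun x => Real.log (laplaceSmoothing μ x)) (μ ∗ ν) := by
    rw [Measure.conv, integrable_map_measure hLc.aestronglyMeasurable (by fun_prop)]
    exact hsum
  refine ⟨(integrable_lebesgueDensity_iff hρ hρ0).1 (hconv ▸ hint), ?_⟩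
  rw [← integral_lebesgueDensity hρ hρ0, ← integral_lebesgueDensity hm.aemeasurable h0, ← hconv,
    Measure.conv, integral_map (by fun_prop) hLc.aestronglyMeasurable]
  have e1 : ∫ x, Real.log (laplaceSmoothing μ x) ∂μ =
      ∫ p, Real.log (laplaceSmoothing μ p.1) ∂(μ.prod ν) := by
    rw [integral_fun_fst (fun x => Real.log (laplaceSmoothing μ x))]; simp
  have e2 : ∫ y, |y| ∂ν = ∫ p, |p.2| ∂(μ.prod ν) := by
    rw [integral_fun_snd (fun y : ℝ => |y|)]; simp
  rw [← hμ, e1, e2, ← integral_sub hsum hfst]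
  refine (abs_integral_le_integral_abs).trans (integral_mono (hsum.sub hfst).abs habs fun p => ?_)
  exact abs_log_laplaceSmoothing_add_sub_le μ p.1 p.2

/-- The integrand lies between two integrable functions: Jensen below, the cross-entropy bound
above. -/
theorem integrable_negMulLog_smear (h0 : 0 ≤ f) (hm : Measurable f)
    (hl : Integrable fun x => Real.negMulLog (f x))
    (hL : Integrable (fun x => Real.log (laplaceSmoothing (lebesgueDensity f) x))
      (lebesgueDensity f)) {ν : Measure ℝ} [IsProbabilityMeasure ν] (hν : Integrable id ν) :
    Integrable fun x => Real.negMulLog (smear f ν x) := by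
  have hf := integrable_of_isFiniteMeasure_lebesgueDensity hm.aemeasurable h0
  have hρ := smear_integrable (ν := ν) hf
  have hup := (((integrable_smear_mul_log_laplaceSmoothing h0 hm hL hν).1.neg).add
    (integrable_laplaceSmoothing (lebesgueDensity f))).sub hρ
  refine (hup.abs.add (smear_integrable (ν := ν) hl).abs).mono'
    (Real.continuous_negMulLog.comp_aestronglyMeasurable hρ.1) ?_
  filter_upwards [smear_negMulLog_le (ν := ν) h0 hf hl] with x hx
  have h1 := negMulLog_le_cross (smear_nonneg (ν := ν) h0 x)
    (laplaceSmoothing_pos (lebesgueDensity f) x)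
  have h2 := h1.trans (le_abs_self _)
  have h3 := (neg_abs_le _).trans hx
  simp only [Real.norm_eq_abs, Pi.add_apply, Pi.sub_apply, Pi.neg_apply]
  exact abs_le.2 ⟨by linarith [abs_nonneg (-(smear f ν x *
    Real.log (laplaceSmoothing (lebesgueDensity f) x)) + laplaceSmoothing (lebesgueDensity f) x -
    smear f ν x)], by linarith [abs_nonneg (smear (fun x => Real.negMulLog (f x)) ν x)]⟩

/-- Fatou's lemma for integrable nonnegative functions with integrable limit. -/
theorem eventually_sub_lt_integral_of_ae_tendsto {k : ℕ → ℝ → ℝ} {k₀ : ℝ → ℝ}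
    (hk0 : ∀ n x, 0 ≤ k n x) (hk : ∀ n, Integrable (k n)) (hk₀0 : ∀ x, 0 ≤ k₀ x)
    (hk₀ : Integrable k₀) (hlim : ∀ᵐ x, Tendsto (fun n => k n x) atTop (𝓝 (k₀ x)))
    {ε : ℝ} (hε : 0 < ε) : ∀ᶠ n in atTop, (∫ x, k₀ x) - ε < ∫ x, k n x := by
  rcases lt_or_ge ((∫ x, k₀ x) - ε) 0 with h | h
  · exact .of_forall fun n => h.trans_le (integral_nonneg (hk0 n))
  have hfatou : ENNReal.ofReal (∫ x, k₀ x) ≤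
      liminf (fun n => ENNReal.ofReal (∫ x, k n x)) atTop := by
    simp_rw [ofReal_integral_eq_lintegral_ofReal hk₀ (.of_forall hk₀0),
      fun n => ofReal_integral_eq_lintegral_ofReal (hk n) (.of_forall (hk0 n))]
    refine le_trans (lintegral_mono_ae ?_)
      (lintegral_liminf_le' fun n => (hk n).1.aemeasurable.ennreal_ofReal)
    filter_upwards [hlim] with x hx
    exact (ENNReal.tendsto_ofReal hx).liminf_eq.ge
  have hlt : ENNReal.ofReal ((∫ x, k₀ x) - ε) <
      liminf (fun n => ENNReal.ofReal (∫ x, k n x)) atTop :=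
    ((ENNReal.ofReal_lt_ofReal_iff (by linarith)).2 (by linarith)).trans_le hfatou
  filter_upwards [eventually_lt_of_lt_liminf hlt] with n hn
  exact (ENNReal.ofReal_lt_ofReal_iff_of_nonneg h).1 hn

theorem tendsto_integral_negMulLog_smear_of_ae (h0 : 0 ≤ f) (hm : Measurable f)
    (hl : Integrable fun x => Real.negMulLog (f x))
    (hL : Integrable (fun x => Real.log (laplaceSmoothing (lebesgueDensity f) x))
      (lebesgueDensity f)) {ν : ℕ → Measure ℝ} [∀ n, IsProbabilityMeasure (ν n)]
    (hν : ∀ n, Integrable id (ν n)) (hν0 : Tendsto (fun n => ∫ y, |y| ∂(ν n)) atTop (𝓝 0))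
    (hae : ∀ᵐ x, Tendsto (fun n => smear f (ν n) x) atTop (𝓝 (f x))) :
    Tendsto (fun n => ∫ x, Real.negMulLog (smear f (ν n) x)) atTop
      (𝓝 (∫ x, Real.negMulLog (f x))) := by
  have hf := integrable_of_isFiniteMeasure_lebesgueDensity hm.aemeasurable h0
  have hint : ∫ x, f x = 1 :=
    integral_eq_one_of_isProbabilityMeasure_lebesgueDensity hm.aemeasurable h0
  set q := laplaceSmoothing (lebesgueDensity f) with hq
  have hqi : Integrable q := integrable_laplaceSmoothing _
  -- The nonnegative gap in `negMulLog_le_cross`. Smearing preserves the mass 1, so the `q` and `r`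
  -- terms cancel when the integrals for two densities are compared.
  let k : (ℝ → ℝ) → ℝ → ℝ := fun r x =>
    -(r x * Real.log (q x)) + q x - r x - Real.negMulLog (r x)
  have hk0 : ∀ r : ℝ → ℝ, 0 ≤ r → ∀ x, 0 ≤ k r x := fun r hr x =>
    sub_nonneg.2 (negMulLog_le_cross (hr x) (laplaceSmoothing_pos _ x))
  have hki : ∀ r : ℝ → ℝ, Integrable r → (Integrable fun x => r x * Real.log (q x)) →
      (Integrable fun x => Real.negMulLog (r x)) → Integrable (k r) ∧ ∫ x, k r x =
        -(∫ x, r x * Real.log (q x)) + (∫ x, q x) - (∫ x, r x) - ∫ x, Real.negMulLog (r x) := by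
    intro r h1 h2 h3
    refine ⟨((h2.neg.add hqi).sub h1).sub h3, ?_⟩
    have e1 := integral_sub ((h2.neg.add hqi).sub h1) h3
    have e2 := integral_sub (h2.neg.add hqi) h1
    have e3 := integral_add h2.neg hqi
    have e4 := integral_neg (μ := volume) fun x => r x * Real.log (q x)
    simp only [Pi.add_apply, Pi.sub_apply, Pi.neg_apply] at e1 e2 e3
    rw [← e4, ← e3, ← e2, ← e1]
  have hρL := fun n => integrable_smear_mul_log_laplaceSmoothing h0 hm hL (hν n)
  have hρl := fun n => integrable_negMulLog_smear h0 hm hl hL (hν n)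
  obtain ⟨hkf, hkf'⟩ := hki f hf ((integrable_lebesgueDensity_iff hm.aemeasurable h0).1 hL) hl
  have hkn := fun n => hki _ (smear_integrable (ν := ν n) hf) (hρL n).1 (hρl n)
  have hklim : ∀ᵐ x, Tendsto (fun n => k (smear f (ν n)) x) atTop (𝓝 (k f x)) := by
    filter_upwards [hae] with x hx
    exact (((hx.mul_const _).neg.add_const _).sub hx).sub
      ((Real.continuous_negMulLog.tendsto _).comp hx)
  rw [Metric.tendsto_atTop']
  intro ε hε
  -- Half of `ε` goes to Fatou, half to the cross-entropy error.
  have hF := eventually_sub_lt_integral_of_ae_tendsto (fun n => hk0 _ (smear_nonneg h0))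
    (fun n => (hkn n).1) (hk0 f h0) hkf hklim (half_pos hε)
  obtain ⟨N, hN⟩ := eventually_atTop.1 (hF.and (hν0.eventually (gt_mem_nhds (half_pos hε))))
  refine ⟨N, fun n hn => ?_⟩
  obtain ⟨h1, h2⟩ := hN n hn.le
  have h3 := integral_negMulLog_le_smear h0 hf hl (hρl n)
  have h4 := (abs_le.1 (hρL n).2).1
  rw [hkf', (hkn n).2, integral_smear hf, hint] at h1
  rw [Real.dist_eq, abs_of_nonneg (sub_nonneg.2 h3)]
  linarith

theorem tendsto_integral_negMulLog_smear_map_mul (h0 : 0 ≤ f) (hm : Measurable f)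
    (hl : Integrable fun x => Real.negMulLog (f x))
    (hL : Integrable (fun x => Real.log (laplaceSmoothing (lebesgueDensity f) x))
      (lebesgueDensity f)) {γ : Measure ℝ} [IsProbabilityMeasure γ] (hγ : Integrable id γ) :
    Tendsto (fun s => ∫ x, Real.negMulLog (smear f (γ.map (s * ·)) x)) (𝓝 0)
      (𝓝 (∫ x, Real.negMulLog (f x))) := by
  have hf := integrable_of_isFiniteMeasure_lebesgueDensity hm.aemeasurable h0
  have hL1 := tendsto_eLpNorm_smear_map_mul_sub hm hf γ
  -- `L¹` convergence gives almost everywhere convergence only along subsequences, which suffices as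
  -- the limit is always the same.
  refine tendsto_of_subseq_tendsto fun s hs => ?_
  obtain ⟨φ, hφ, hae⟩ := (tendstoInMeasure_of_tendsto_eLpNorm one_ne_zero
    (fun n => (smear_integrable hf).1) hf.1 (hL1.comp hs)).exists_seq_tendsto_ae
  refine ⟨φ, tendsto_integral_negMulLog_smear_of_ae h0 hm hl hL
    (ν := fun n => γ.map (s (φ n) * ·)) (fun n => ?_) ?_ hae⟩
  · rw [integrable_map_measure (by fun_prop) (by fun_prop)]
    exact hγ.const_mul _
  · have h : ∀ n, ∫ y, |y| ∂(γ.map (s (φ n) * ·)) = |s (φ n)| * ∫ y, |y| ∂γ := fun n => by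
      rw [integral_map (by fun_prop) (by fun_prop), ← integral_const_mul]
      simp only [abs_mul]
    simp_rw [h]
    have := ((hs.comp hφ.tendsto_atTop).abs).mul_const (∫ y, |y| ∂γ)
    rw [abs_zero, zero_mul] at this
    exact this

end EntropyLimit

/-- Jensen rules out the case where the value `⊥` is a mere convention, so that `h(X + Y) < ⊤`
really bounds the positive part. No moment of `ν` is needed. -/
theorem lintegral_neg_negMulLog_smear_ne_top {f : ℝ → ℝ} (h0 : 0 ≤ f) (hf : Integrable f)
    (hl : Integrable fun x => Real.negMulLog (f x)) (ν : Measure ℝ) [IsProbabilityMeasure ν] :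
    ∫⁻ x, ENNReal.ofReal (-Real.negMulLog (smear f ν x)) ≠ ⊤ := by
  refine ne_top_of_le_ne_top
    (lintegral_ofReal_ne_top_of_integrable (smear_integrable (ν := ν) hl).neg) (lintegral_mono_ae ?_)
  filter_upwards [smear_negMulLog_le (ν := ν) h0 hf hl] with x hx
  exact ENNReal.ofReal_le_ofReal (neg_le_neg hx)

/-- `X` and `Z ∼ N(0,1)` are independent on `Ω`. The independent `Y` may live on another probability
space `Ω'`, which carries a copy `X'` of `X`; taking `Ω' = Ω` and `X' = X` is a special case. -/
theorem theorem2 {Ω Ω' : Type*} [MeasurableSpace Ω] [MeasurableSpace Ω']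
    (P : Measure Ω) [IsProbabilityMeasure P] (P' : Measure Ω') [IsProbabilityMeasure P']
    (X Z : Ω → ℝ) (X' Y : Ω' → ℝ)
    (hX : AEMeasurable X P) (hY : AEMeasurable Y P')
    (hX_fin : ⊥ < diffEntropy X P ∧ diffEntropy X P < ⊤)
    (hX' : IdentDistrib X' X P' P) (hX'Y : IndepFun X' Y P')
    (hY_fin : ⊥ < diffEntropy Y P' ∧ diffEntropy Y P' < ⊤)
    (hX'Y_fin : diffEntropy (fun ω => X' ω + Y ω) P' < ⊤)
    (hZ : HasLaw Z (gaussianReal 0 1) P) (hXZ : IndepFun X Z P) :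
    Tendsto (fun t : ℝ => diffEntropy (fun ω => X ω + √t * Z ω) P) (𝓝[>] 0)
      (𝓝 (diffEntropy X P)) := by
  obtain ⟨f, hf0, hfm, hXf, hfl⟩ := exists_density_of_diffEntropy_finite hX_fin
  obtain ⟨g, hg0, hgm, hYg, hgl⟩ := exists_density_of_diffEntropy_finite hY_fin
  have : IsProbabilityMeasure (lebesgueDensity f) :=
    hXf.map_eq ▸ Measure.isProbabilityMeasure_map hX
  have : IsProbabilityMeasure (lebesgueDensity g) :=
    hYg.map_eq ▸ Measure.isProbabilityMeasure_map hY
  have hfi := integrable_of_isFiniteMeasure_lebesgueDensity hfm.aemeasurable hf0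
  have hXf' : HasLaw X' (lebesgueDensity f) P' :=
    ⟨hX'.aemeasurable_fst, hX'.map_eq.trans hXf.map_eq⟩
  have hsum : HasLaw (fun ω => X' ω + Y ω) (lebesgueDensity (smear f (lebesgueDensity g))) P' := by
    rw [← lebesgueDensity_conv hf0 hfm hfi]
    exact hX'Y.hasLaw_fun_add hXf' hYg
  have hsl := integrable_negMulLog_of_diffEntropy_lt_top hsum (smear_nonneg hf0)
    (smear_integrable hfi).aemeasurable
    (lintegral_neg_negMulLog_smear_ne_top hf0 hfi hfl _) hX'Y_fin
  have hL := integrable_log_laplaceSmoothing hf0 hfm hg0 hgm hgl hsl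
  have hid : Integrable id (gaussianReal 0 1) :=
    memLp_one_iff_integrable.1 (memLp_id_gaussianReal 1)
  have hlim := tendsto_integral_negMulLog_smear_map_mul hf0 hfm hfl hL hid
  have hsqrt : Tendsto Real.sqrt (𝓝[>] 0) (𝓝 0) := by
    have := Real.continuous_sqrt.tendsto 0
    rw [Real.sqrt_zero] at this
    exact this.mono_left nhdsWithin_le_nhds
  rw [diffEntropy_eq_integral hXf hf0 hfm.aemeasurable hfl]
  -- Every perturbed entropy is a finite real integral, so the limit in `EReal` reduces to the one
  -- in `ℝ`.
  refine (((continuous_coe_real_ereal.tendsto _).comp (hlim.comp hsqrt))).congr fun t => ?_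
  have hZt : HasLaw (fun ω => √t * Z ω) ((gaussianReal 0 1).map (√t * ·)) P :=
    ⟨hZ.aemeasurable.const_mul _, by
      rw [← hZ.map_eq, AEMeasurable.map_map_of_aemeasurable (by fun_prop) hZ.aemeasurable]
      rfl⟩
  have hXZt : HasLaw (fun ω => X ω + √t * Z ω)
      (lebesgueDensity (smear f ((gaussianReal 0 1).map (√t * ·)))) P := by
    rw [← lebesgueDensity_conv hf0 hfm hfi]
    exact (hXZ.comp measurable_id (measurable_const_mul (√t))).hasLaw_fun_add hXf hZt
  refine (diffEntropy_eq_integral hXZt (smear_nonneg hf0) (smear_integrable hfi).aemeasurable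
    (integrable_negMulLog_smear hf0 hfm hfl hL ?_)).symm
  rw [integrable_map_measure (by fun_prop) (by fun_prop)]
  exact hid.const_mul _
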